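/- Let $n\ge 2$ and $\epsilon\in(0,1)$. A bid-reporting (prior-independent) single-item mechanism $M=(x,p)$ for $n$ buyers consists of measurable rules $x_i:\mathbb{R}_+^n\to[0,1]$, with $\sum_i x_i(b)\le 1$ for all $b$, and $p_i:\mathbb{R}_+^n\to\mathbb{R}$, which depend on the bids only. It is incentive compatible (IC) if $v_i x_i(v)-p_i(v)\ge v_i x_i(r,v_{-i})-p_i(r,v_{-i})$, and individually rational (IR) if $v_i x_i(v)-p_i(v)\ge 0$, for all $v\in\mathbb{R}_+^n$, $i\in\{1,\dots,n\}$ and $r\in\mathbb{R}_+$. For a profile $\mathbf F=(F_1,\dots,F_n)$ of distributions on $\mathbb{R}_+$ and independent $v_i\sim F_i$, let $\mathrm{REV}(M;\mathbf F)=\mathbb{E}[\sum_i p_i(v)]\in[-\infty,\infty]$, let $\mathrm{WEL}(\mathbf F)=\mathbb{E}[\max_i v_i]$, and let $\mathrm{SPA}(\mathbf F)$ be the expected second-highest of $v_1,\dots,v_n$ (with multiplicity). A distribution on $\mathbb{R}_+$ with cumulative distribution function $F$ is regular if it has a density $f$ on $\{F<1\}$ (so an atom is allowed only at the top of the support) which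 is positive on $\{0<F<1\}$ and can be chosen so that the virtual value $x-\frac{1-F(x)}{f(x)}$ is nondecreasing there. For $H>1$, the equal-revenue distribution truncated at $H$ is the law of $1/\max\{q,1/H\}$ for $q$ uniform on $[0,1]$. Then for every feasible, IC and IR bid-reporting mechanism $M$ as above there is an $H>1$ such that the equal-revenue distribution $F$ truncated at $H$ is regular and the instance $\mathbf F=(F,\dots,F)$ of identical distributions satisfies $\mathrm{WEL}(\mathbf F)<\infty$ and $$\mathrm{REV}(M;\mathbf F)<\min\{\epsilon\cdot\mathrm{WEL}(\mathbf F),\,(1+\epsilon)\cdot\mathrm{SPA}(\mathbf F)\}.$$ -/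

import Mathlib

open MeasureTheory ProbabilityTheory
open scoped NNReal ENNReal

noncomputable section

/-- A (possibly randomized) single-item bid-reporting, i.e. prior-independent, mechanism for `n`
buyers: at the bid profile `b`, buyer `i` gets the item with probability `alloc b i` and is charged
the (expected) payment `pay b i`. The rules see the bids only, never the distributions. -/
structure BidMechanism (n : ℕ) where
  alloc : (Fin n → ℝ≥0) → Fin n → ℝ
  pay : (Fin n → ℝ≥0) → Fin n → ℝ
  measurable_alloc : Measurable alloc
  measurable_pay : Measurable pay

namespace BidMechanism

variable {n : ℕ}

/-- Single-item feasibility: allocation probabilities are in `[0,1]`, with total at most one. -/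
def Feasible (M : BidMechanism n) : Prop :=
  ∀ b : Fin n → ℝ≥0, (∀ i, 0 ≤ M.alloc b i ∧ M.alloc b i ≤ 1) ∧ ∑ i, M.alloc b i ≤ 1

/-- Utility of buyer `i` with value `v` when the submitted bid profile is `b`. -/
def utility (M : BidMechanism n) (i : Fin n) (v : ℝ≥0) (b : Fin n → ℝ≥0) : ℝ :=
  (v : ℝ) * M.alloc b i - M.pay b i

/-- (Dominant-strategy) incentive compatibility: whatever the others bid (`v j`, `j ≠ i`), bidding
the true value `v i` is at least as good for buyer `i` as any other bid `r`. -/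
def IsIC (M : BidMechanism n) : Prop :=
  ∀ (v : Fin n → ℝ≥0) (i : Fin n) (r : ℝ≥0),
    M.utility i (v i) (Function.update v i r) ≤ M.utility i (v i) v

/-- (Ex-post) individual rationality: a truthful buyer never has negative utility. -/
def IsIR (M : BidMechanism n) : Prop :=
  ∀ (v : Fin n → ℝ≥0) (i : Fin n), 0 ≤ M.utility i (v i) v

/-- Expected revenue under truthful bids drawn independently, `v i ∼ F i`: the expected total
payment, as an extended real number (positive part minus negative part), since payments to the
buyers may have infinite expectation. -/
def revenue (M : BidMechanism n) (F : Fin n → Measure ℝ≥0) : EReal :=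
  ((∫⁻ v, ENNReal.ofReal (∑ i, M.pay v i) ∂(Measure.pi F) : ℝ≥0∞) : EReal) -
    ((∫⁻ v, ENNReal.ofReal (-∑ i, M.pay v i) ∂(Measure.pi F) : ℝ≥0∞) : EReal)

end BidMechanism

/-- The second-highest entry of `v`, with multiplicity: the largest value of `min (v i) (v j)` over
two distinct indices. -/
def secondMax {n : ℕ} (v : Fin n → ℝ≥0) : ℝ≥0∞ :=
  ⨆ (i : Fin n) (j : Fin n) (_ : i ≠ j), ((min (v i) (v j) : ℝ≥0) : ℝ≥0∞)

/-- Optimal social welfare: the expected highest value. -/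
def WEL {n : ℕ} (F : Fin n → Measure ℝ≥0) : ℝ≥0∞ :=
  ∫⁻ v, (⨆ i, (v i : ℝ≥0∞)) ∂(Measure.pi F)

/-- Second-price auction revenue: the expected second-highest value. -/
def SPA {n : ℕ} (F : Fin n → Measure ℝ≥0) : ℝ≥0∞ :=
  ∫⁻ v, secondMax v ∂(Measure.pi F)

/-- The cumulative distribution function of a distribution on the nonnegative reals, on `ℝ`. -/
def cdfNN (F : Measure ℝ≥0) (x : ℝ) : ℝ :=
  cdf (F.map ((↑) : ℝ≥0 → ℝ)) x

/-- Regularity of a distribution on the nonnegative reals. Below the top of its support the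
distribution has a density `f`; on `{0 < F(x) < 1}` (an interval) the density is positive and the
virtual value `x - (1 - F(x)) / f(x)` is nondecreasing. An atom is allowed only at the top of the
support, so that truncated distributions and point masses are included; this is the same as
concavity of the revenue curve `q ↦ q * v(q)`, where `v` is the quantile function. -/
def IsRegularDist (F : Measure ℝ≥0) : Prop :=
  ∃ f : ℝ → ℝ, Measurable f ∧
    (F.map ((↑) : ℝ≥0 → ℝ)).restrict {x | cdfNN F x < 1} =
      (volume.withDensity fun x => ENNReal.ofReal (f x)).restrict {x | cdfNN F x < 1} ∧
    (∀ x, 0 < cdfNN F x → cdfNN F x < 1 → 0 < f x) ∧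
    MonotoneOn (fun x => x - (1 - cdfNN F x) / f x) {x | 0 < cdfNN F x ∧ cdfNN F x < 1}

/-- The equal-revenue distribution truncated at `H`: the law of `v(q) = 1 / max {q, 1/H}` for a
uniform quantile `q ∈ [0,1]`. -/
def truncatedEqualRevenue (H : ℝ) : Measure ℝ≥0 :=
  (volume.restrict (Set.Icc (0 : ℝ) 1)).map fun q => Real.toNNReal (1 / max q (1 / H))

end

/-!
Fix the bids of the others. Incentive compatibility says that the allocation `x` of a buyer is a
selection of subgradients of his utility `U v = v * x v - p v`, so `p v / v ^ 2` is the derivative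
of `U v / v`. As `v⁻²` is the density of the equal-revenue distribution below the truncation point
`H`, the expected payment telescopes to `x H - U 1`, provided `p 0 = 0`; individual rationality
lets one replace payments by their excess over the payment at value `0`. Hence every mechanism
earns at most `1` from each buyer, and at most `n` in total, for every `H`.

On the other side, the expected value `1 + log H` of a single buyer is unbounded, and a second-price
auction extracts the full `1` from each buyer as soon as the best competing value `m` lies in
`[1, H)`, because `m * ℙ(v > m) = 1` there; this event has probability at least `(1 - 1/H) ^ (n-1)`,
so the second-price revenue is eventually above every bound less than `n`.
-/

open Set Filter Topology

/-- `P` is a selection of subgradients of `R` on `S`: for every `s ∈ S` the affine function through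
`(s, R s)` with slope `P s` lies below `R` on `S`. Incentive compatibility of a single-buyer
mechanism says exactly that the allocation is a selection of subgradients of the utility. -/
def IsSubgradientOn (P R : ℝ → ℝ) (S : Set ℝ) : Prop :=
  ∀ s ∈ S, ∀ t ∈ S, R s + P s * (t - s) ≤ R t

namespace IsSubgradientOn

variable {P R : ℝ → ℝ} {S T : Set ℝ} {a b : ℝ}

theorem mono (h : IsSubgradientOn P R S) (hTS : T ⊆ S) : IsSubgradientOn P R T :=
  fun s hs t ht => h s (hTS hs) t (hTS ht)

theorem monotoneOn (h : IsSubgradientOn P R S) : MonotoneOn P S := by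
  intro s hs t ht hst
  rcases hst.eq_or_lt with rfl | hlt
  · rfl
  have hprod : 0 ≤ (P t - P s) * (t - s) := by linarith [h s hs t ht, h t ht s hs]
  exact sub_nonneg.1 (nonneg_of_mul_nonneg_left hprod (sub_pos.2 hlt))

theorem hasDerivAt {x : ℝ} (h : IsSubgradientOn P R S) (hS : S ∈ 𝓝 x) (hP : ContinuousAt P x) :
    HasDerivAt R (P x) x := by
  rw [hasDerivAt_iff_isLittleO, Asymptotics.isLittleO_iff]
  intro ε hε
  have hx := mem_of_mem_nhds hS
  filter_upwards [hS, Metric.continuousAt_iff'.1 hP ε hε] with t ht hPt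
  have hlower := h x hx t ht
  have hupper := h t ht x hx
  calc ‖R t - R x - (t - x) • P x‖ = R t - R x - (t - x) * P x := by
        rw [smul_eq_mul, Real.norm_of_nonneg (by linarith)]
    _ ≤ (P t - P x) * (t - x) := by linarith
    _ ≤ |P t - P x| * |t - x| := by rw [← abs_mul]; exact le_abs_self _
    _ ≤ ε * ‖t - x‖ := mul_le_mul_of_nonneg_right hPt.le (abs_nonneg _)

theorem continuousOn_Icc (h : IsSubgradientOn P R (Icc a b)) : ContinuousOn R (Icc a b) := by
  refine (LipschitzOnWith.of_le_add_mul' (max |P a| |P b|) fun s hs t ht => ?_).continuousOn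
  have hab := hs.1.trans hs.2
  have hP : |P s| ≤ max |P a| |P b| := abs_le_max_abs_abs
    (h.monotoneOn (left_mem_Icc.2 hab) hs hs.1) (h.monotoneOn hs (right_mem_Icc.2 hab) hs.2)
  calc R s ≤ R t + P s * (s - t) := by linarith [h s hs t ht]
    _ ≤ R t + |P s| * |s - t| := by rw [← abs_mul]; gcongr; exact le_abs_self _
    _ ≤ R t + max |P a| |P b| * dist s t := by rw [Real.dist_eq]; gcongr

/-- Off the countably many discontinuities of `P`, the integrand is the derivative of `R v / v`. -/
theorem integral_mul_sub_div_sq (h : IsSubgradientOn P R (Icc a b)) (ha : 0 < a) (hab : a ≤ b) :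
    IntervalIntegrable (fun v => (v * P v - R v) / v ^ 2) volume a b ∧
      ∫ v in a..b, (v * P v - R v) / v ^ 2 = R b / b - R a / a := by
  have hne : ∀ v ∈ Icc a b, v ≠ 0 := fun v hv => (ha.trans_le hv.1).ne'
  have hint : IntervalIntegrable (fun v => (v * P v - R v) / v ^ 2) volume a b := by
    have hP : IntervalIntegrable P volume a b :=
      MonotoneOn.intervalIntegrable (by rw [uIcc_of_le hab]; exact h.monotoneOn)
    have hR : IntervalIntegrable R volume a b := h.continuousOn_Icc.intervalIntegrable_of_Icc hab
    refine ((hP.continuousOn_mul continuousOn_id).sub hR).mul_continuousOn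
      (g := fun v => (v ^ 2)⁻¹) ?_
    rw [uIcc_of_le hab]
    exact (continuousOn_pow 2).inv₀ fun v hv => pow_ne_zero 2 (hne v hv)
  refine ⟨hint, integral_eq_of_hasDerivAt_off_countable_of_le (fun v => R v / v) _ hab
    h.monotoneOn.countable_not_continuousWithinAt
    (h.continuousOn_Icc.div continuousOn_id hne) ?_ hint⟩
  rintro v ⟨hv, hPv⟩
  have hnhds : Icc a b ∈ 𝓝 v := Icc_mem_nhds hv.1 hv.2
  have hcont : ContinuousAt P v := by
    by_contra hdisc
    exact hPv ⟨Ioo_subset_Icc_self hv, fun hw => hdisc (hw.continuousAt hnhds)⟩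
  have hdiv := (h.hasDerivAt hnhds hcont).fun_div (hasDerivAt_id' v)
    (hne v (Ioo_subset_Icc_self hv))
  rwa [mul_one, mul_comm (P v)] at hdiv

end IsSubgradientOn

section EqualRevenue

variable {H t : ℝ}

instance isProbabilityMeasure_truncatedEqualRevenue (H : ℝ) :
    IsProbabilityMeasure (truncatedEqualRevenue H) := by
  have : IsProbabilityMeasure (volume.restrict (Icc (0 : ℝ) 1)) := ⟨by simp⟩
  exact Measure.isProbabilityMeasure_map (by fun_prop)

theorem image_inv_Ico_of_pos {a b : ℝ} (ha : 0 < a) (hb : 0 < b) :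
    Inv.inv '' Ico a b = Ioc b⁻¹ a⁻¹ := by
  rw [image_eq_preimage_of_inverse inv_inv inv_inv]
  ext q
  simp only [mem_preimage, mem_Ico, mem_Ioc]
  constructor
  · rintro ⟨haq, hqb⟩
    have hq : 0 < q := inv_pos.1 (ha.trans_le haq)
    exact ⟨inv_lt_of_inv_lt₀ hq hqb, (le_inv_comm₀ ha hq).1 haq⟩
  · rintro ⟨hbq, hqa⟩
    have hq : 0 < q := (inv_pos.2 hb).trans hbq
    exact ⟨(le_inv_comm₀ ha hq).2 hqa, inv_lt_of_inv_lt₀ hb hbq⟩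

theorem lintegral_map_coe_truncatedEqualRevenue (hH : 1 ≤ H) {g : ℝ → ℝ≥0∞} (hg : Measurable g) :
    ∫⁻ x, g x ∂(truncatedEqualRevenue H).map ((↑) : ℝ≥0 → ℝ) =
      (∫⁻ x in Ico 1 H, ENNReal.ofReal (x ^ 2)⁻¹ * g x) + ENNReal.ofReal H⁻¹ * g H := by
  have hH0 : 0 < H⁻¹ := inv_pos.2 (one_pos.trans_le hH)
  have hquantile : ∀ q : ℝ, ((1 / max q (1 / H)).toNNReal : ℝ) = (max q H⁻¹)⁻¹ := fun q => by
    rw [one_div, one_div, Real.coe_toNNReal _ (by positivity)]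
  have himage : Inv.inv '' Ico 1 H = Ioc H⁻¹ 1 := by
    rw [image_inv_Ico_of_pos one_pos (inv_pos.1 hH0), inv_one]
  have hatom : ∫⁻ q in Ioc 0 H⁻¹, g (max q H⁻¹)⁻¹ = ENNReal.ofReal H⁻¹ * g H := by
    rw [setLIntegral_congr_fun measurableSet_Ioc fun q hq => by rw [max_eq_right hq.2, inv_inv],
      setLIntegral_const, Real.volume_Ioc, sub_zero, mul_comm]
  have hcontinuous : ∫⁻ q in Ioc H⁻¹ 1, g (max q H⁻¹)⁻¹ =
      ∫⁻ x in Ico 1 H, ENNReal.ofReal (x ^ 2)⁻¹ * g x := by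
    have hderiv : ∀ x ∈ Ico 1 H, HasDerivWithinAt Inv.inv (-(x ^ 2)⁻¹) (Ico 1 H) x :=
      fun x hx => (hasDerivAt_inv (one_pos.trans_le hx.1).ne').hasDerivWithinAt
    rw [setLIntegral_congr_fun measurableSet_Ioc fun q hq => by rw [max_eq_left hq.1.le], ← himage,
      lintegral_image_eq_lintegral_abs_deriv_mul measurableSet_Ico hderiv inv_injective.injOn]
    simp only [inv_inv, abs_neg, abs_inv, abs_sq]
  calc ∫⁻ x, g x ∂(truncatedEqualRevenue H).map ((↑) : ℝ≥0 → ℝ)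
      = ∫⁻ q in Icc 0 1, g (max q H⁻¹)⁻¹ := by
        rw [lintegral_map hg measurable_coe_nnreal_real, truncatedEqualRevenue,
          lintegral_map (by fun_prop) (by fun_prop)]
        simp only [hquantile]
    _ = ∫⁻ q in Ioc 0 H⁻¹ ∪ Ioc H⁻¹ 1, g (max q H⁻¹)⁻¹ := by
        rw [Ioc_union_Ioc_eq_Ioc hH0.le (inv_le_one_of_one_le₀ hH),
          setLIntegral_congr Ioc_ae_eq_Icc]
    _ = _ := by
        rw [lintegral_union measurableSet_Ioc (Ioc_disjoint_Ioc_of_le le_rfl), hatom, hcontinuous,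
          add_comm]

theorem map_coe_truncatedEqualRevenue (hH : 1 ≤ H) :
    (truncatedEqualRevenue H).map ((↑) : ℝ≥0 → ℝ) =
      (volume.restrict (Ico 1 H)).withDensity (fun x => ENNReal.ofReal (x ^ 2)⁻¹) +
        ENNReal.ofReal H⁻¹ • Measure.dirac H := by
  refine Measure.ext_of_lintegral _ fun g hg => ?_
  rw [lintegral_map_coe_truncatedEqualRevenue hH hg, lintegral_add_measure,
    lintegral_withDensity_eq_lintegral_mul _ (by fun_prop) hg, lintegral_smul_measure,
    lintegral_dirac' _ hg]
  rfl

theorem lintegral_truncatedEqualRevenue (hH : 1 ≤ H) {g : ℝ≥0 → ℝ≥0∞} (hg : Measurable g) :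
    ∫⁻ v, g v ∂truncatedEqualRevenue H =
      (∫⁻ x in Ico 1 H, ENNReal.ofReal (x ^ 2)⁻¹ * g x.toNNReal) +
        ENNReal.ofReal H⁻¹ * g H.toNNReal := by
  have hg' : Measurable fun x : ℝ => g x.toNNReal := by fun_prop
  rw [← lintegral_map_coe_truncatedEqualRevenue hH hg',
    lintegral_map hg' measurable_coe_nnreal_real]
  simp only [Real.toNNReal_coe]

theorem setLIntegral_Ico_ofReal {f : ℝ → ℝ} {a b : ℝ} (hab : a ≤ b)
    (hf : IntervalIntegrable f volume a b) (hf0 : ∀ x ∈ Ico a b, 0 ≤ f x) :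
    ∫⁻ x in Ico a b, ENNReal.ofReal (f x) = ENNReal.ofReal (∫ x in a..b, f x) := by
  rw [intervalIntegral.integral_of_le hab, ← integral_Ico_eq_integral_Ioc,
    ofReal_integral_eq_lintegral_ofReal]
  · exact (intervalIntegrable_iff_integrableOn_Ico_of_le hab).1 hf
  · exact (ae_restrict_iff' measurableSet_Ico).2 (ae_of_all _ hf0)

theorem setLIntegral_Ico_inv_sq {a b : ℝ} (ha : 0 < a) (hab : a ≤ b) :
    ∫⁻ x in Ico a b, ENNReal.ofReal (x ^ 2)⁻¹ = ENNReal.ofReal (a⁻¹ - b⁻¹) := by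
  have h0 : (0 : ℝ) ∉ uIcc a b := by
    rw [uIcc_of_le hab]; exact fun h => ha.not_ge h.1
  have hderiv : ∀ x ∈ uIcc a b, HasDerivAt (fun x : ℝ => -x⁻¹) (x ^ 2)⁻¹ x := fun x hx => by
    simpa using (hasDerivAt_inv (ne_of_mem_of_not_mem hx h0)).fun_neg
  have hint : IntervalIntegrable (fun x : ℝ => (x ^ 2)⁻¹) volume a b :=
    intervalIntegral.intervalIntegrable_inv
      (fun x hx => pow_ne_zero 2 (ne_of_mem_of_not_mem hx h0)) (continuousOn_pow 2)
  rw [setLIntegral_Ico_ofReal hab hint fun x _ => by positivity,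
    intervalIntegral.integral_eq_sub_of_hasDerivAt hderiv hint, neg_sub_neg]

theorem lintegral_coe_truncatedEqualRevenue (hH : 1 ≤ H) :
    ∫⁻ v, (v : ℝ≥0∞) ∂truncatedEqualRevenue H = ENNReal.ofReal (1 + Real.log H) := by
  have hH0 : 0 < H := one_pos.trans_le hH
  have h0 : (0 : ℝ) ∉ uIcc 1 H := by
    rw [uIcc_of_le hH]; exact fun h => one_pos.not_ge h.1
  have hdensity : ∫⁻ x in Ico 1 H, ENNReal.ofReal (x ^ 2)⁻¹ * (x.toNNReal : ℝ≥0∞) =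
      ENNReal.ofReal (Real.log H) := by
    have hinv : ∀ x ∈ Ico 1 H, ENNReal.ofReal (x ^ 2)⁻¹ * (x.toNNReal : ℝ≥0∞) =
        ENNReal.ofReal x⁻¹ := fun x hx => by
      have hx0 : 0 < x := one_pos.trans_le hx.1
      rw [← ENNReal.ofReal, ← ENNReal.ofReal_mul (by positivity), sq, mul_inv,
        inv_mul_cancel_right₀ hx0.ne']
    rw [setLIntegral_congr_fun measurableSet_Ico hinv, setLIntegral_Ico_ofReal hH
      (intervalIntegral.intervalIntegrable_inv (fun x hx => ne_of_mem_of_not_mem hx h0)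
        continuousOn_id) fun x hx => inv_nonneg.2 (zero_le_one.trans hx.1),
      integral_inv h0, div_one]
  rw [lintegral_truncatedEqualRevenue hH measurable_coe_nnreal_ennreal, hdensity, ← ENNReal.ofReal,
    ← ENNReal.ofReal_mul (by positivity), inv_mul_cancel₀ hH0.ne', add_comm,
    ENNReal.ofReal_add zero_le_one (Real.log_nonneg hH)]

theorem map_coe_truncatedEqualRevenue_apply (hH : 1 ≤ H) {S : Set ℝ} (hS : MeasurableSet S) :
    (truncatedEqualRevenue H).map ((↑) : ℝ≥0 → ℝ) S =
      (∫⁻ x in S ∩ Ico 1 H, ENNReal.ofReal (x ^ 2)⁻¹) +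
        ENNReal.ofReal H⁻¹ * S.indicator 1 H := by
  rw [map_coe_truncatedEqualRevenue hH, Measure.add_apply, withDensity_apply _ hS,
    Measure.restrict_restrict hS, Measure.smul_apply, Measure.dirac_apply' _ hS, smul_eq_mul]

theorem truncatedEqualRevenue_Ioi (hH : 1 ≤ H) {m : ℝ≥0} (hm : 1 ≤ m) (hmH : (m : ℝ) < H) :
    truncatedEqualRevenue H (Ioi m) = (m : ℝ≥0∞)⁻¹ := by
  have hm1 : (1 : ℝ) ≤ m := hm
  have hm0 : (0 : ℝ) < m := one_pos.trans_le hm1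
  have hset : Ioi (m : ℝ) ∩ Ico 1 H = Ioo (m : ℝ) H := by grind
  have hpreimage : ((↑) : ℝ≥0 → ℝ) ⁻¹' Ioi (m : ℝ) = Ioi m := by ext; simp
  rw [← hpreimage, ← Measure.map_apply measurable_coe_nnreal_real measurableSet_Ioi,
    map_coe_truncatedEqualRevenue_apply hH measurableSet_Ioi, hset,
    setLIntegral_congr Ioo_ae_eq_Ico, setLIntegral_Ico_inv_sq hm0 hmH.le,
    indicator_of_mem (mem_Ioi.2 hmH), Pi.one_apply, mul_one,
    ← ENNReal.ofReal_add (sub_nonneg.2 (inv_anti₀ hm0 hmH.le)) (by positivity), sub_add_cancel,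
    ENNReal.ofReal_inv_of_pos hm0, ENNReal.ofReal_coe_nnreal]

theorem truncatedEqualRevenue_Ico (hH : 1 ≤ H) :
    truncatedEqualRevenue H (Ico 1 H.toNNReal) = ENNReal.ofReal (1 - H⁻¹) := by
  have hpreimage : ((↑) : ℝ≥0 → ℝ) ⁻¹' Ico 1 H = Ico 1 H.toNNReal := by
    ext v; simp [Real.lt_toNNReal_iff_coe_lt]
  rw [← hpreimage, ← Measure.map_apply measurable_coe_nnreal_real measurableSet_Ico,
    map_coe_truncatedEqualRevenue_apply hH measurableSet_Ico, inter_self,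
    setLIntegral_Ico_inv_sq one_pos hH, indicator_of_notMem right_notMem_Ico, mul_zero, add_zero,
    inv_one]

theorem cdfNN_truncatedEqualRevenue (hH : 1 ≤ H) (t : ℝ) :
    cdfNN (truncatedEqualRevenue H) t = if t < 1 then 0 else if t < H then 1 - t⁻¹ else 1 := by
  have := Measure.isProbabilityMeasure_map (μ := truncatedEqualRevenue H)
    measurable_coe_nnreal_real.aemeasurable
  rw [cdfNN, cdf_eq_real, measureReal_def,
    map_coe_truncatedEqualRevenue_apply hH measurableSet_Iic]
  split_ifs with h1 h2
  · have hset : Iic t ∩ Ico 1 H = ∅ := by grind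
    simp [hset, h1.trans_le hH]
  · have hset : Iic t ∩ Ico 1 H = Icc 1 t := by grind
    rw [not_lt] at h1
    rw [hset, setLIntegral_congr Ico_ae_eq_Icc.symm, setLIntegral_Ico_inv_sq one_pos h1]
    simp [h2, inv_le_one_of_one_le₀ h1]
  · have hset : Iic t ∩ Ico 1 H = Ico 1 H := by grind
    rw [not_lt] at h2
    rw [hset, setLIntegral_Ico_inv_sq one_pos hH, indicator_of_mem (mem_Iic.2 h2), Pi.one_apply,
      mul_one, ← ENNReal.ofReal_add (by simp [inv_le_one_of_one_le₀ hH]) (by positivity)]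
    simp

theorem cdfNN_truncatedEqualRevenue_lt_one_iff (hH : 1 ≤ H) :
    cdfNN (truncatedEqualRevenue H) t < 1 ↔ t < H := by
  rw [cdfNN_truncatedEqualRevenue hH]
  split_ifs with h1 h2
  · simp [h1.trans_le hH]
  · simp [h2, one_pos.trans_le (not_lt.1 h1)]
  · simp [h2]

theorem one_le_of_cdfNN_truncatedEqualRevenue_pos (hH : 1 ≤ H)
    (ht : 0 < cdfNN (truncatedEqualRevenue H) t) : 1 ≤ t := by
  contrapose! ht
  rw [cdfNN_truncatedEqualRevenue hH, if_pos ht]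

theorem restrict_Iio_map_coe_truncatedEqualRevenue (hH : 1 ≤ H) :
    ((truncatedEqualRevenue H).map ((↑) : ℝ≥0 → ℝ)).restrict (Iio H) =
      (volume.withDensity fun x =>
        ENNReal.ofReal ((Ici 1).indicator (fun x : ℝ => (x ^ 2)⁻¹) x)).restrict (Iio H) := by
  have hdensity : (fun x => ENNReal.ofReal ((Ici 1).indicator (fun x : ℝ => (x ^ 2)⁻¹) x)) =
      (Ici 1).indicator fun x => ENNReal.ofReal (x ^ 2)⁻¹ :=
    (indicator_comp_of_zero ENNReal.ofReal_zero).symm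
  have hset : Iio H ∩ Ico 1 H = Iio H ∩ Ici 1 := by grind
  rw [hdensity, withDensity_indicator measurableSet_Ici, map_coe_truncatedEqualRevenue hH,
    Measure.restrict_add, Measure.restrict_smul, restrict_dirac' measurableSet_Iio,
    if_neg self_notMem_Iio, smul_zero, add_zero, restrict_withDensity measurableSet_Iio,
    restrict_withDensity measurableSet_Iio, Measure.restrict_restrict measurableSet_Iio,
    Measure.restrict_restrict measurableSet_Iio, hset]

theorem virtualValue_truncatedEqualRevenue_eq_zero (hH : 1 ≤ H)
    (h0 : 0 < cdfNN (truncatedEqualRevenue H) t) (h1 : cdfNN (truncatedEqualRevenue H) t < 1) :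
    t - (1 - cdfNN (truncatedEqualRevenue H) t) / (Ici 1).indicator (fun x => (x ^ 2)⁻¹) t = 0 := by
  have ht := one_le_of_cdfNN_truncatedEqualRevenue_pos hH h0
  have ht0 : t ≠ 0 := (one_pos.trans_le ht).ne'
  rw [indicator_of_mem (mem_Ici.2 ht), cdfNN_truncatedEqualRevenue hH, if_neg ht.not_gt,
    if_pos ((cdfNN_truncatedEqualRevenue_lt_one_iff hH).1 h1)]
  field_simp
  ring

theorem isRegularDist_truncatedEqualRevenue (hH : 1 ≤ H) :
    IsRegularDist (truncatedEqualRevenue H) := by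
  have hlt : {x | cdfNN (truncatedEqualRevenue H) x < 1} = Iio H :=
    Set.ext fun _ => cdfNN_truncatedEqualRevenue_lt_one_iff hH
  refine ⟨(Ici 1).indicator fun x => (x ^ 2)⁻¹, ?_, ?_, fun x h0 _ => ?_, fun x hx y hy _ => ?_⟩
  · exact Measurable.indicator (by fun_prop) measurableSet_Ici
  · rw [hlt, restrict_Iio_map_coe_truncatedEqualRevenue hH]
  · have hx := one_le_of_cdfNN_truncatedEqualRevenue_pos hH h0
    rw [indicator_of_mem (mem_Ici.2 hx)]
    exact inv_pos.2 (pow_pos (one_pos.trans_le hx) 2)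
  · exact (virtualValue_truncatedEqualRevenue_eq_zero hH hx.1 hx.2).trans_le
      (virtualValue_truncatedEqualRevenue_eq_zero hH hy.1 hy.2).ge

end EqualRevenue

section SingleBuyer

variable {x p : ℝ≥0 → ℝ} {H : ℝ}

theorem isSubgradientOn_utility (hIC : ∀ v r : ℝ≥0, (v : ℝ) * x r - p r ≤ v * x v - p v) :
    IsSubgradientOn (fun v => x v.toNNReal) (fun v => v * x v.toNNReal - p v.toNNReal) (Ici 0) := by
  intro s _ t ht
  have hICst := hIC t.toNNReal s.toNNReal
  rw [Real.coe_toNNReal t ht] at hICst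
  linarith

theorem monotone_pay (hIC : ∀ v r : ℝ≥0, (v : ℝ) * x r - p r ≤ v * x v - p v) : Monotone p := by
  intro s t hst
  have hx : x s ≤ x t := by
    simpa only [Real.toNNReal_coe] using
      (isSubgradientOn_utility hIC).monotoneOn s.coe_nonneg t.coe_nonneg (NNReal.coe_le_coe.2 hst)
  linarith [hIC s t, mul_le_mul_of_nonneg_left hx s.coe_nonneg]

theorem lintegral_pay_truncatedEqualRevenue (hH : 1 ≤ H)
    (hIC : ∀ v r : ℝ≥0, (v : ℝ) * x r - p r ≤ v * x v - p v) (hp : 0 ≤ p 0) :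
    ∫⁻ v, ENNReal.ofReal (p v) ∂truncatedEqualRevenue H =
      ENNReal.ofReal (x H.toNNReal - (x 1 - p 1)) := by
  have : 0 < H := one_pos.trans_le hH
  have hp_mono := monotone_pay hIC
  have hp_nonneg : ∀ v, 0 ≤ p v := fun v => hp.trans (hp_mono zero_le)
  obtain ⟨hint, hutility⟩ := ((isSubgradientOn_utility hIC).mono (Icc_subset_Ici_self.trans
    (Ici_subset_Ici.2 zero_le_one))).integral_mul_sub_div_sq one_pos hH
  simp only [sub_sub_cancel] at hint hutility
  have hdensity : ∫⁻ v in Ico 1 H, ENNReal.ofReal (v ^ 2)⁻¹ * ENNReal.ofReal (p v.toNNReal) =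
      ENNReal.ofReal (∫ v in 1..H, p v.toNNReal / v ^ 2) := by
    rw [← setLIntegral_Ico_ofReal hH hint fun v _ => div_nonneg (hp_nonneg _) (sq_nonneg v)]
    congr with v
    rw [← ENNReal.ofReal_mul (by positivity), div_eq_inv_mul]
  rw [lintegral_truncatedEqualRevenue hH hp_mono.measurable.ennreal_ofReal, hdensity,
    ← ENNReal.ofReal_mul (by positivity), ← ENNReal.ofReal_add
      (intervalIntegral.integral_nonneg hH fun v _ => div_nonneg (hp_nonneg _) (sq_nonneg v))
      (mul_nonneg (by positivity) (hp_nonneg _)), hutility]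
  congr 1
  simp only [Real.toNNReal_one]
  field_simp
  ring

theorem lintegral_pay_truncatedEqualRevenue_le_one (hH : 1 ≤ H) (hx : ∀ v, x v ∈ Icc (0 : ℝ) 1)
    (hIC : ∀ v r : ℝ≥0, (v : ℝ) * x r - p r ≤ v * x v - p v) (hp : p 0 = 0) :
    ∫⁻ v, ENNReal.ofReal (p v) ∂truncatedEqualRevenue H ≤ 1 := by
  have hutility : 0 ≤ x 1 - p 1 := by
    have hIC10 := hIC 1 0
    rw [NNReal.coe_one, one_mul, one_mul, hp, sub_zero] at hIC10
    exact (hx 0).1.trans hIC10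
  rw [lintegral_pay_truncatedEqualRevenue hH hIC hp.ge, ENNReal.ofReal_le_one]
  linarith [(hx H.toNNReal).2]

end SingleBuyer

theorem lintegral_pi_mono_of_update {ι : Type*} [Fintype ι] [DecidableEq ι] {X : ι → Type*}
    [∀ i, MeasurableSpace (X i)] (μ : ∀ i, Measure (X i)) [∀ i, SigmaFinite (μ i)] (i : ι)
    {f g : (∀ i, X i) → ℝ≥0∞} (hf : Measurable f) (hg : Measurable g)
    (hfg : ∀ v, ∫⁻ t, f (Function.update v i t) ∂μ i ≤ ∫⁻ t, g (Function.update v i t) ∂μ i) :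
    ∫⁻ v, f v ∂Measure.pi μ ≤ ∫⁻ v, g v ∂Measure.pi μ := by
  cases isEmpty_or_nonempty (∀ i, X i) with
  | inl _ => simp only [lintegral_of_isEmpty, le_refl]
  | inr hX =>
    obtain ⟨v₀⟩ := hX
    rw [lintegral_eq_lmarginal_univ v₀, lintegral_eq_lmarginal_univ v₀,
      lmarginal_erase' f hf (Finset.mem_univ i), lmarginal_erase' g hg (Finset.mem_univ i)]
    exact lmarginal_mono hfg v₀

namespace BidMechanism

variable {n : ℕ} {M : BidMechanism n}

/-- The payment of buyer `i` in excess of the charge for bidding `0` against the same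
bids of the others. -/
noncomputable def netPay (M : BidMechanism n) (v : Fin n → ℝ≥0) (i : Fin n) : ℝ :=
  M.pay v i - M.pay (Function.update v i 0) i

theorem netPay_update (v : Fin n → ℝ≥0) (i : Fin n) (t : ℝ≥0) :
    M.netPay (Function.update v i t) i =
      M.pay (Function.update v i t) i - M.pay (Function.update v i 0) i := by
  rw [netPay, Function.update_idem]

theorem measurable_netPay (i : Fin n) : Measurable fun v => M.netPay v i := by
  have hupdate : Measurable fun v : Fin n → ℝ≥0 => Function.update v i 0 :=
    measurable_update_left
  have hpay := measurable_pi_iff.1 M.measurable_pay i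
  exact hpay.sub (hpay.comp hupdate)

theorem IsIR.pay_le_netPay (hIR : M.IsIR) (v : Fin n → ℝ≥0) (i : Fin n) :
    M.pay v i ≤ M.netPay v i := by
  have hzero := hIR (Function.update v i 0) i
  rw [utility, Function.update_self, NNReal.coe_zero, zero_mul, zero_sub] at hzero
  rw [netPay]
  linarith

theorem IsIR.revenue_le_sum_lintegral_netPay (hIR : M.IsIR) (F : Fin n → Measure ℝ≥0) :
    M.revenue F ≤ ((∑ i, ∫⁻ v, ENNReal.ofReal (M.netPay v i) ∂Measure.pi F : ℝ≥0∞) : EReal) := by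
  refine (EReal.sub_le_sub le_rfl (EReal.coe_ennreal_nonneg _)).trans
    ((sub_zero _).trans_le (EReal.coe_ennreal_le_coe_ennreal_iff.2 ?_))
  rw [← lintegral_finsetSum _ fun i _ => (measurable_netPay i).ennreal_ofReal]
  refine lintegral_mono fun v => ?_
  calc ENNReal.ofReal (∑ i, M.pay v i) ≤ ENNReal.ofReal (∑ i, M.netPay v i) :=
        ENNReal.ofReal_le_ofReal (Finset.sum_le_sum fun i _ => hIR.pay_le_netPay v i)
    _ ≤ ∑ i, ENNReal.ofReal (M.netPay v i) :=
        Finset.le_sum_of_subadditive _ ENNReal.ofReal_zero.le (fun _ _ => ENNReal.ofReal_add_le) _ _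

theorem IsIC.lintegral_netPay_le_one (hIC : M.IsIC) (hM : ∀ b i, M.alloc b i ∈ Icc (0 : ℝ) 1)
    {H : ℝ} (hH : 1 ≤ H) (i : Fin n) :
    ∫⁻ v, ENNReal.ofReal (M.netPay v i) ∂(Measure.pi fun _ => truncatedEqualRevenue H) ≤ 1 := by
  calc ∫⁻ v, ENNReal.ofReal (M.netPay v i) ∂(Measure.pi fun _ => truncatedEqualRevenue H)
      ≤ ∫⁻ _, 1 ∂(Measure.pi fun _ : Fin n => truncatedEqualRevenue H) := ?_
    _ = 1 := by simp
  refine lintegral_pi_mono_of_update _ i (measurable_netPay i).ennreal_ofReal measurable_const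
    fun v => ?_
  rw [lintegral_one, measure_univ]
  refine lintegral_pay_truncatedEqualRevenue_le_one hH
    (x := fun t => M.alloc (Function.update v i t) i)
    (p := fun t => M.netPay (Function.update v i t) i) (fun _ => hM _ i) (fun t r => ?_) ?_
  · have hICtr := hIC (Function.update v i t) i r
    simp only [utility, Function.update_self, Function.update_idem] at hICtr
    simp only [netPay_update]
    linarith
  · rw [netPay_update, sub_self]

theorem revenue_truncatedEqualRevenue_le (hM : ∀ b i, M.alloc b i ∈ Icc (0 : ℝ) 1) (hIC : M.IsIC)
    (hIR : M.IsIR) {H : ℝ} (hH : 1 ≤ H) :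
    M.revenue (fun _ => truncatedEqualRevenue H) ≤ ((n : ℝ≥0∞) : EReal) := by
  refine (hIR.revenue_le_sum_lintegral_netPay _).trans (EReal.coe_ennreal_le_coe_ennreal_iff.2 ?_)
  calc ∑ i, ∫⁻ v, ENNReal.ofReal (M.netPay v i) ∂(Measure.pi fun _ => truncatedEqualRevenue H)
      ≤ ∑ _i : Fin n, 1 := Finset.sum_le_sum fun i _ => hIC.lintegral_netPay_le_one hM hH i
    _ = n := by simp

end BidMechanism

section Welfare

variable {n : ℕ} {H : ℝ}

theorem lintegral_eval_truncatedEqualRevenue (hH : 1 ≤ H) (i : Fin n) :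
    ∫⁻ v, (v i : ℝ≥0∞) ∂(Measure.pi fun _ => truncatedEqualRevenue H) =
      ENNReal.ofReal (1 + Real.log H) := by
  rw [← lintegral_coe_truncatedEqualRevenue hH]
  exact (measurePreserving_eval (fun _ => truncatedEqualRevenue H) i).lintegral_comp
    measurable_coe_nnreal_ennreal

theorem WEL_le_sum_lintegral_eval (F : Fin n → Measure ℝ≥0) :
    WEL F ≤ ∑ i, ∫⁻ v, (v i : ℝ≥0∞) ∂Measure.pi F := by
  rw [← lintegral_finsetSum _ fun i _ => by fun_prop]
  exact lintegral_mono fun v => iSup_le fun i =>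
    Finset.single_le_sum (f := fun i => (v i : ℝ≥0∞)) (fun _ _ => zero_le) (Finset.mem_univ i)

theorem WEL_truncatedEqualRevenue_lt_top (hH : 1 ≤ H) :
    WEL (fun _ : Fin n => truncatedEqualRevenue H) < ⊤ := by
  refine (WEL_le_sum_lintegral_eval _).trans_lt (ENNReal.sum_lt_top.2 fun i _ => ?_)
  rw [lintegral_eval_truncatedEqualRevenue hH]
  exact ENNReal.ofReal_lt_top

theorem ofReal_one_add_log_le_WEL [NeZero n] (hH : 1 ≤ H) :
    ENNReal.ofReal (1 + Real.log H) ≤ WEL (fun _ : Fin n => truncatedEqualRevenue H) := by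
  rw [← lintegral_eval_truncatedEqualRevenue hH (0 : Fin n)]
  exact lintegral_mono fun v => le_iSup (fun i => (v i : ℝ≥0∞)) 0

theorem tendsto_WEL_truncatedEqualRevenue [NeZero n] :
    Tendsto (fun H => WEL (fun _ : Fin n => truncatedEqualRevenue H)) atTop (𝓝 ⊤) := by
  have hlog : Tendsto (fun H => ENNReal.ofReal (1 + Real.log H)) atTop (𝓝 ⊤) :=
    ENNReal.tendsto_ofReal_atTop.comp
      (tendsto_atTop_add_const_left _ 1 Real.tendsto_log_atTop)
  refine tendsto_nhds_top_mono hlog ?_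
  filter_upwards [eventually_ge_atTop 1] with H hH using ofReal_one_add_log_le_WEL hH

end Welfare

section SecondPrice

variable {ι : Type*} [Fintype ι] [DecidableEq ι]

/-- The highest of the values `v j` with `j ≠ i`, which is the price buyer `i` faces in a
second-price auction; it is `0` if there are no other buyers. -/
def maxOthers (v : ι → ℝ≥0) (i : ι) : ℝ≥0 :=
  (Finset.univ.erase i).sup v

/-- The payment of buyer `i` in a second-price auction in which ties leave the item unsold, so that
there is at most one winner and no tie-breaking rule is needed. -/
noncomputable def secondPricePay (v : ι → ℝ≥0) (i : ι) : ℝ≥0∞ :=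
  (Iio (v i)).indicator (↑) (maxOthers v i)

theorem le_maxOthers (v : ι → ℝ≥0) {i j : ι} (hji : j ≠ i) : v j ≤ maxOthers v i :=
  Finset.le_sup (Finset.mem_erase.2 ⟨hji, Finset.mem_univ j⟩)

theorem maxOthers_update (v : ι → ℝ≥0) (i : ι) (t : ℝ≥0) :
    maxOthers (Function.update v i t) i = maxOthers v i :=
  Finset.sup_congr rfl fun _ hj => Function.update_of_ne (Finset.ne_of_mem_erase hj) _ _

theorem measurable_maxOthers (i : ι) : Measurable fun v : ι → ℝ≥0 => maxOthers v i :=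
  (Continuous.finset_sup_apply fun j _ => continuous_apply j).measurable

theorem measurable_secondPricePay (i : ι) :
    Measurable fun v : ι → ℝ≥0 => secondPricePay v i :=
  Measurable.ite (measurableSet_lt (measurable_maxOthers i) (measurable_pi_apply i))
    (measurable_maxOthers i).coe_nnreal_ennreal measurable_const

theorem sum_secondPricePay_le_secondMax {n : ℕ} (v : Fin n → ℝ≥0) :
    ∑ i, secondPricePay v i ≤ secondMax v := by
  by_cases hwinner : ∃ i, maxOthers v i < v i
  · obtain ⟨i, hi⟩ := hwinner
    have hloser : ∀ j, j ≠ i → secondPricePay v j = 0 := fun j hji =>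
      indicator_of_notMem (fun hj => (hi.trans_le (le_maxOthers v hji.symm)).not_gt
        (hj.trans_le (le_maxOthers v hji))) _
    rw [Fintype.sum_eq_single i hloser, secondPricePay, indicator_of_mem (mem_Iio.2 hi), maxOthers,
      ENNReal.coe_finset_sup]
    refine Finset.sup_le fun j hj => ?_
    have hji := Finset.ne_of_mem_erase hj
    have hmin : min (v i) (v j) = v j := min_eq_right ((le_maxOthers v hji).trans hi.le)
    rw [← hmin]
    exact le_iSup_of_le i (le_iSup_of_le j (le_iSup_of_le hji.symm le_rfl))
  · push Not at hwinner
    have hunsold : ∑ i, secondPricePay v i = 0 :=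
      Finset.sum_eq_zero fun i _ => indicator_of_notMem (notMem_Iio.2 (hwinner i)) _
    exact hunsold.trans_le zero_le

theorem sum_lintegral_secondPricePay_le_SPA {n : ℕ} (F : Fin n → Measure ℝ≥0) :
    ∑ i, ∫⁻ v, secondPricePay v i ∂Measure.pi F ≤ SPA F := by
  rw [← lintegral_finsetSum _ fun i _ => measurable_secondPricePay i]
  exact lintegral_mono sum_secondPricePay_le_secondMax

variable {H : ℝ}

theorem lintegral_secondPricePay_update_truncatedEqualRevenue (hH : 1 ≤ H) (v : ι → ℝ≥0) (i : ι)
    (hv : maxOthers v i ∈ Ico 1 H.toNNReal) :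
    ∫⁻ t, secondPricePay (Function.update v i t) i ∂truncatedEqualRevenue H = 1 := by
  have hpay : ∀ t, secondPricePay (Function.update v i t) i =
      (Ioi (maxOthers v i)).indicator (fun _ => (maxOthers v i : ℝ≥0∞)) t := fun t => by
    rw [secondPricePay, maxOthers_update, Function.update_self]
    rfl
  have hne : (maxOthers v i : ℝ≥0∞) ≠ 0 := ENNReal.coe_ne_zero.2 (one_pos.trans_le hv.1).ne'
  simp only [hpay]
  rw [lintegral_indicator_const measurableSet_Ioi, truncatedEqualRevenue_Ioi hH hv.1
    (Real.lt_toNNReal_iff_coe_lt.1 hv.2), ENNReal.mul_inv_cancel hne ENNReal.coe_ne_top]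

theorem measure_maxOthers_le_lintegral_secondPricePay (hH : 1 ≤ H) (i : ι) :
    Measure.pi (fun _ : ι => truncatedEqualRevenue H) {v | maxOthers v i ∈ Ico 1 H.toNNReal} ≤
      ∫⁻ v, secondPricePay v i ∂(Measure.pi fun _ => truncatedEqualRevenue H) := by
  have hmeas : MeasurableSet {v : ι → ℝ≥0 | maxOthers v i ∈ Ico 1 H.toNNReal} :=
    measurable_maxOthers i measurableSet_Ico
  rw [← lintegral_indicator_one hmeas]
  refine lintegral_pi_mono_of_update _ i (measurable_one.indicator hmeas)
    (measurable_secondPricePay i) fun v => ?_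
  by_cases hv : maxOthers v i ∈ Ico 1 H.toNNReal
  · rw [lintegral_secondPricePay_update_truncatedEqualRevenue hH v i hv]
    calc ∫⁻ t, indicator _ 1 (Function.update v i t) ∂truncatedEqualRevenue H
        ≤ ∫⁻ _, 1 ∂truncatedEqualRevenue H :=
          lintegral_mono fun t => indicator_le_self' (fun _ _ => zero_le) _
      _ = 1 := by rw [lintegral_one, measure_univ]
  · have hout : ∀ t, Function.update v i t ∉ {v | maxOthers v i ∈ Ico 1 H.toNNReal} := fun t => by
      rwa [mem_ofPred_eq, maxOthers_update]
    simp only [indicator_of_notMem (hout _), lintegral_zero, zero_le]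

theorem pow_le_measure_maxOthers_truncatedEqualRevenue [Nontrivial ι] (hH : 1 ≤ H) (i : ι) :
    ENNReal.ofReal (1 - H⁻¹) ^ (Fintype.card ι - 1) ≤
      Measure.pi (fun _ : ι => truncatedEqualRevenue H) {v | maxOthers v i ∈ Ico 1 H.toNNReal} := by
  obtain ⟨j, hji⟩ := exists_ne i
  have hH0 : 0 < H.toNNReal := Real.toNNReal_pos.2 (one_pos.trans_le hH)
  calc ENNReal.ofReal (1 - H⁻¹) ^ (Fintype.card ι - 1)
      = ∏ _j ∈ Finset.univ.erase i, truncatedEqualRevenue H (Ico 1 H.toNNReal) := by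
        rw [Finset.prod_const, Finset.card_erase_of_mem (Finset.mem_univ i), Finset.card_univ,
          truncatedEqualRevenue_Ico hH]
    _ = Measure.pi (fun _ : ι => truncatedEqualRevenue H)
          (Set.pi (Finset.univ.erase i) fun _ => Ico 1 H.toNNReal) :=
        (Measure.pi_pi_finset _ _ _).symm
    _ ≤ _ := measure_mono fun v hv => ?_
  exact ⟨(hv j (by simpa using hji)).1.trans (le_maxOthers v hji),
    (Finset.sup_lt_iff hH0).2 fun k hk => (hv k hk).2⟩

theorem mul_pow_le_SPA_truncatedEqualRevenue {n : ℕ} (hn : 2 ≤ n) (hH : 1 ≤ H) :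
    n * ENNReal.ofReal (1 - H⁻¹) ^ (n - 1) ≤ SPA (fun _ : Fin n => truncatedEqualRevenue H) := by
  have : Nontrivial (Fin n) := Fin.nontrivial_iff_two_le.2 hn
  calc (n : ℝ≥0∞) * ENNReal.ofReal (1 - H⁻¹) ^ (n - 1)
      = ∑ _i : Fin n, ENNReal.ofReal (1 - H⁻¹) ^ (Fintype.card (Fin n) - 1) := by simp
    _ ≤ ∑ i, ∫⁻ v, secondPricePay v i ∂(Measure.pi fun _ : Fin n => truncatedEqualRevenue H) :=
        Finset.sum_le_sum fun i _ => (pow_le_measure_maxOthers_truncatedEqualRevenue hH i).trans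
          (measure_maxOthers_le_lintegral_secondPricePay hH i)
    _ ≤ _ := sum_lintegral_secondPricePay_le_SPA _

theorem eventually_lt_SPA_truncatedEqualRevenue {n : ℕ} (hn : 2 ≤ n) {c : ℝ≥0∞} (hc : c < n) :
    ∀ᶠ H in atTop, c < SPA (fun _ : Fin n => truncatedEqualRevenue H) := by
  have hbase : Tendsto (fun H : ℝ => ENNReal.ofReal (1 - H⁻¹)) atTop (𝓝 1) := by
    simpa using ENNReal.tendsto_ofReal ((tendsto_inv_atTop_zero (𝕜 := ℝ)).const_sub 1)
  have hbound : Tendsto (fun H : ℝ => (n : ℝ≥0∞) * ENNReal.ofReal (1 - H⁻¹) ^ (n - 1)) atTop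
      (𝓝 n) := by
    simpa using ENNReal.Tendsto.const_mul (ENNReal.Tendsto.pow hbase)
      (Or.inr (ENNReal.natCast_ne_top n))
  filter_upwards [hbound.eventually_const_lt hc, eventually_ge_atTop 1] with H hcH hH
  exact hcH.trans_le (mul_pow_le_SPA_truncatedEqualRevenue hn hH)

end SecondPrice

theorem mainTheorem8_general (n : ℕ) (hn : 2 ≤ n) (ε : ℝ) (hε : 0 < ε) :
    ∀ᶠ H : ℝ in atTop, 1 < H ∧ IsRegularDist (truncatedEqualRevenue H) ∧
      WEL (fun _ : Fin n => truncatedEqualRevenue H) < ⊤ ∧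
      ∀ M : BidMechanism n, (∀ b i, M.alloc b i ∈ Icc (0 : ℝ) 1) → M.IsIC → M.IsIR →
        M.revenue (fun _ => truncatedEqualRevenue H) <
          ((min (ENNReal.ofReal ε * WEL (fun _ : Fin n => truncatedEqualRevenue H))
            (ENNReal.ofReal (1 + ε) * SPA (fun _ : Fin n => truncatedEqualRevenue H)) : ℝ≥0∞) :
            EReal) := by
  have : NeZero n := ⟨by lia⟩
  have hε0 : ENNReal.ofReal ε ≠ 0 := (ENNReal.ofReal_pos.2 hε).ne'
  have hone_add : 1 < ENNReal.ofReal (1 + ε) := by simpa using hε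
  have hWEL_lt : ↑n / ENNReal.ofReal ε < ⊤ := ENNReal.div_lt_top (ENNReal.natCast_ne_top n) hε0
  have hSPA_lt : ↑n / ENNReal.ofReal (1 + ε) < n := by
    rw [ENNReal.div_lt_iff (Or.inl (zero_lt_one.trans hone_add).ne') (Or.inl ENNReal.ofReal_ne_top)]
    simpa using ENNReal.mul_lt_mul_right (a := n) (by simp [NeZero.ne n]) (by simp) hone_add
  filter_upwards [eventually_gt_atTop 1,
    (tendsto_WEL_truncatedEqualRevenue (n := n)).eventually_const_lt hWEL_lt,
    eventually_lt_SPA_truncatedEqualRevenue hn hSPA_lt] with H hH hWEL hSPA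
  refine ⟨hH, isRegularDist_truncatedEqualRevenue hH.le, WEL_truncatedEqualRevenue_lt_top hH.le,
    fun M hM hIC hIR => (M.revenue_truncatedEqualRevenue_le hM hIC hIR hH.le).trans_lt
      (EReal.coe_ennreal_lt_coe_ennreal_iff.2 (lt_min ?_ ?_))⟩
  · rwa [mul_comm, ← ENNReal.div_lt_iff (Or.inl hε0) (Or.inl ENNReal.ofReal_ne_top)]
  · rwa [mul_comm, ← ENNReal.div_lt_iff (Or.inl (zero_lt_one.trans hone_add).ne')
      (Or.inl ENNReal.ofReal_ne_top)]

theorem mainTheorem8 (n : ℕ) (hn : 2 ≤ n) (ε : ℝ) (hε₀ : 0 < ε) (hε₁ : ε < 1)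
    (M : BidMechanism n) (hfeas : M.Feasible) (hIC : M.IsIC) (hIR : M.IsIR) :
    ∃ (H : ℝ) (F : Measure ℝ≥0), 1 < H ∧ F = truncatedEqualRevenue H ∧
      IsProbabilityMeasure F ∧ IsRegularDist F ∧ WEL (fun _ : Fin n => F) < ⊤ ∧
      M.revenue (fun _ => F) <
        ((min (ENNReal.ofReal ε * WEL (fun _ : Fin n => F))
          (ENNReal.ofReal (1 + ε) * SPA (fun _ : Fin n => F)) : ℝ≥0∞) : EReal) := by
  obtain ⟨H, hH, hreg, hWEL, hrev⟩ := (mainTheorem8_general n hn ε hε₀).exists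
  exact ⟨H, _, hH, rfl, inferInstance, hreg, hWEL, hrev M (fun b => (hfeas b).1) hIC hIR⟩
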